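/- Let $n\ge 0$, $\hat n=\{0,\dots,n\}$, $\Delta=\{x\in\mathbb R^{n+1}: x_i\ge 0,\ \sum x_i=1\}$, and let $\mathbb T^n=(\mathbb R/2\pi\mathbb Z)^{n+1}/(\mathbb R/2\pi\mathbb Z)$ be the torus with homogeneous coordinates $[\theta_0,\dots,\theta_n]$. For $I\subseteq J\subseteq\hat n$ with $|I|\ge 2$ let $$H_{IJ}=\{x\in\Delta:\ x_i=x_{i'}\ge x_k \text{ for all } i,i'\in I,\ k\notin I,\ \text{ and } x_j=0 \text{ for } j\notin J\},$$ let $\mathcal C^I\subseteq\mathbb T^n$ be the closure of the set of all $[\arg z_0,\dots,\arg z_n]$ with $z\in(\mathbb C^*)^{n+1}$ and $\sum_{i\in I}z_i=0$, and let $$\mathcal P=\bigcup_{I\subseteq J,\ |I|\ge 2} H_{IJ}\times\mathcal C^I\ \subseteq\ \Delta\times\mathbb T^n$$ be the phase tropical pair-of-pants. Let $J\subseteq\hat n$ and let $\Delta_J=\{x\in\Delta: x_j=0 \text{ for } j\notin J\}$. Let $\sigma=\langle I_1,\dots,I_k\rangle$ be a cyclic partition of $\hat n$ into non-empty parts, let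 $\Delta_\sigma=\{\alpha\in\mathbb R^k:\alpha_s\ge 0,\ \sum\alpha_s=2\pi\}$, and let $q_\sigma:\Delta_\sigma\to\mathbb T^n$ send $\alpha$ to the class $[\theta]$ with $\theta_i=\theta_j$ for $i,j\in I_s$ and $\theta_i+\alpha_s=\theta_j$ for $i\in I_s$, $j\in I_{s+1}$ (indices modulo $k$). Set $$\mathcal P_{\sigma,J}=\{(x,\alpha)\in\Delta_J\times\Delta_\sigma:\ (x,q_\sigma(\alpha))\in\mathcal P\}.$$ **Lemma.** If $\sigma$ divides $J$, that is, if $J$ contains elements of at least two parts of $\sigma$, then the complement $(\Delta_J\times\Delta_\sigma)\setminus\mathcal P_{\sigma,J}$ is homotopy equivalent to a circle. -/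

import Mathlib

open scoped BigOperators ContinuousMap

noncomputable section

namespace PhaseTropical

/-- The torus `𝕋ⁿ = (ℝ/2πℤ)ⁿ⁺¹ / (ℝ/2πℤ)` with homogeneous coordinates `[θ₀, …, θₙ]`: the quotient
of `(ℝ/2πℤ)ⁿ⁺¹` by the diagonal circle, with the quotient topology. -/
abbrev Torus (n : ℕ) : Type :=
  (Fin (n + 1) → Real.Angle) ⧸ (Pi.constAddMonoidHom (Fin (n + 1)) Real.Angle).range

/-- The point `[θ₀, …, θₙ]` of the torus. -/
def Torus.mk {n : ℕ} (θ : Fin (n + 1) → Real.Angle) : Torus n := QuotientAddGroup.mk θ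

/-- The face `Δ_J` of the standard `n`-simplex `Δ ⊆ ℝⁿ⁺¹`. -/
def simplexFace {n : ℕ} (J : Finset (Fin (n + 1))) : Set (Fin (n + 1) → ℝ) :=
  {x | x ∈ stdSimplex ℝ (Fin (n + 1)) ∧ ∀ j, j ∉ J → x j = 0}

/-- The face `H_{IJ}` of the spine of the amoeba: the points of `Δ` with
`x_i = x_{i'} ≥ x_k` for `i, i' ∈ I`, `k ∉ I`, and `x_j = 0` for `j ∉ J`. -/
def spineFace {n : ℕ} (I J : Finset (Fin (n + 1))) : Set (Fin (n + 1) → ℝ) :=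
  {x | x ∈ stdSimplex ℝ (Fin (n + 1)) ∧
    (∀ i ∈ I, ∀ i' ∈ I, x i = x i') ∧
    (∀ i ∈ I, ∀ k, k ∉ I → x k ≤ x i) ∧
    ∀ j, j ∉ J → x j = 0}

/-- The partial coamoeba `𝒞^I ⊆ 𝕋ⁿ`: the closure of the set of arguments `[arg z₀, …, arg zₙ]`
of the points `[z₀, …, zₙ] ∈ (ℂ*)ⁿ⁺¹/ℂ*` with `∑_{i ∈ I} z_i = 0`. -/
def partialCoamoeba {n : ℕ} (I : Finset (Fin (n + 1))) : Set (Torus n) :=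
  closure {t | ∃ z : Fin (n + 1) → ℂ, (∀ i, z i ≠ 0) ∧ ∑ i ∈ I, z i = 0 ∧
    t = Torus.mk (fun i => (Complex.arg (z i) : Real.Angle))}

/-- The phase tropical pair-of-pants `𝒫 = ⋃ H_{IJ} × 𝒞^I ⊆ Δ × 𝕋ⁿ`,
the union over all pairs `I ⊆ J` with `|I| ≥ 2`. -/
def pairOfPants (n : ℕ) : Set ((Fin (n + 1) → ℝ) × Torus n) :=
  {p | ∃ I J : Finset (Fin (n + 1)), I ⊆ J ∧ 2 ≤ I.card ∧
    p.1 ∈ spineFace I J ∧ p.2 ∈ partialCoamoeba I}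

/-- A cyclic partition `σ = ⟨I_0, …, I_{k-1}⟩` of `{0, …, n}` into non-empty parts, written as a
list that starts at some part; `part i` is the position of the part that contains `i`, and
the part `I_0` follows `I_{k-1}` in the cyclic order. -/
structure CyclicPartition (n : ℕ) where
  /-- the number `|σ|` of parts -/
  card : ℕ
  /-- the part to which an element belongs -/
  part : Fin (n + 1) → Fin card
  /-- every part is non-empty -/
  part_surjective : Function.Surjective part

namespace CyclicPartition

variable {n : ℕ} (σ : CyclicPartition n)

/-- `σ` divides `J` if `J` contains elements in at least two parts of `σ`. -/
def Divides (J : Finset (Fin (n + 1))) : Prop :=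
  ∃ i ∈ J, ∃ j ∈ J, σ.part i ≠ σ.part j

/-- The simplex `Δ_σ = {α ∈ ℝᵏ : α_s ≥ 0, ∑ α_s = 2π}`. -/
def simplex : Set (Fin σ.card → ℝ) :=
  {α | (∀ s, 0 ≤ α s) ∧ ∑ s, α s = 2 * Real.pi}

/-- The map `Δ_σ → 𝕋ⁿ` onto the closed stratum of `σ`. Its value `[θ]` at `α` is the class
with `θ_i = θ_j` for `i, j ∈ I_s`, and `θ_i + α_s = θ_j` for `i ∈ I_s`, `j ∈ I_{s+1}`
(indices mod `k`), normalized by `θ_i = 0` for `i ∈ I_0`. -/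
def toTorus (α : Fin σ.card → ℝ) : Torus n :=
  Torus.mk fun i => ((∑ s ∈ Finset.univ.filter (fun s => s < σ.part i), α s : ℝ) : Real.Angle)

/-- The stratum `𝒫_{σ,J}` of `𝒫`, seen in `Δ_J × Δ_σ`. -/
def pantsStratum (J : Finset (Fin (n + 1))) :
    Set ((Fin (n + 1) → ℝ) × (Fin σ.card → ℝ)) :=
  {p | p.1 ∈ simplexFace J ∧ p.2 ∈ σ.simplex ∧ (p.1, σ.toTorus p.2) ∈ pairOfPants n}

end CyclicPartition

end PhaseTropical

end

/-! ### Partial coamoebas and open half-planes. -/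

open Filter Topology

namespace PhaseTropical

/-! A point `(x, [θ])` avoids the pair-of-pants exactly when the unit vectors `exp(iθ_i)`, with `i`
running over the maxima of `x`, lie in an open half-plane (`notMem_pairOfPants_iff`). The directions
`v` of such half-planes form a convex set and stay valid nearby, so a partition of unity yields a
continuous direction map to the circle (`exists_direction`). Its homotopy inverse `loop` sends `u`
to a configuration whose moving points are gathered at one angle, together with weights on the
points visible from `u`. One composite is homotopic to the identity because two valid directions are
never opposite. For the other, `x` slides to the weights visible from its direction, and then `α`
slides to the gathered configuration; `sees_segment` and `total_segment_pos` keep both slides in the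
complement. Two kinds of points are needed: a fixed one at angle 0, visible from the open right half
of the circle, and a moving one for the rest. They exist because `σ` divides `J`. -/

theorem continuous_angle_toCircle : Continuous Real.Angle.toCircle :=
  Circle.exp.continuous.quotient_lift _

/-- Finitely many vectors that do not lie in an open half-plane have a nontrivial
nonnegative relation. -/
theorem exists_weights_of_forall_not_pos {ι : Type*} [Fintype ι] (P : ι → ℂ)
    (h : ¬ ∃ v : ℂ, ∀ i, 0 < inner ℝ (P i) v) :
    ∃ w ∈ stdSimplex ℝ ι, ∑ i, w i • P i = 0 := by
  by_contra hcon
  push Not at hcon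
  set K : Set ℂ := Fintype.linearCombination ℝ P '' stdSimplex ℝ ι with hK
  have hKc : IsCompact K := (isCompact_stdSimplex ℝ ι).image
    (LinearMap.continuous_of_finiteDimensional _)
  have hKconv : Convex ℝ K := (convex_stdSimplex ℝ ι).linear_image _
  have h0 : (0 : ℂ) ∉ K := by
    rintro ⟨w, hw, hw0⟩
    exact hcon w hw (by simpa [Fintype.linearCombination_apply] using hw0)
  obtain ⟨f, u, hu, hf⟩ := geometric_hahn_banach_point_closed hKconv hKc.isClosed h0
  classical
  -- The Riesz vector of a functional separating 0 from the convex hull of the points.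
  refine h ⟨(InnerProductSpace.toDual ℝ ℂ).symm f, fun i => ?_⟩
  rw [real_inner_comm, InnerProductSpace.toDual_symm_apply]
  have := hf (P i) ⟨Pi.single i 1, single_mem_stdSimplex ℝ i, by
    simp [Fintype.linearCombination_apply_single]⟩
  simp only [map_zero] at hu
  linarith

variable {n : ℕ}

theorem Torus.mk_eq_mk_iff {θ φ : Fin (n + 1) → Real.Angle} :
    Torus.mk θ = Torus.mk φ ↔ ∃ c : Real.Angle, ∀ i, φ i = θ i + c := by
  unfold Torus.mk
  rw [QuotientAddGroup.eq]
  constructor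
  · rintro ⟨c, hc⟩
    refine ⟨c, fun i => ?_⟩
    have := congrFun hc i
    simp only [Pi.constAddMonoidHom_apply, Pi.add_apply, Pi.neg_apply, Function.const_apply] at this
    rw [this]; abel
  · rintro ⟨c, hc⟩
    refine ⟨c, funext fun i => ?_⟩
    simp [hc i]

theorem toCircle_arg {z : ℂ} (hz : z ≠ 0) :
    ((Complex.arg z : Real.Angle).toCircle : ℂ) = (‖z‖ : ℂ)⁻¹ * z := by
  have h : (‖z‖ : ℂ) ≠ 0 := by simpa using hz
  rw [Real.Angle.toCircle_coe, Circle.coe_exp]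
  rw [eq_inv_mul_iff_mul_eq₀ h, Complex.norm_mul_exp_arg_mul_I]

/-- The half-plane condition is open and the quotient map is open, so membership in the closure
would give a genuine zero sum whose terms, up to a common rotation, all lie in the half-plane. -/
theorem mk_notMem_partialCoamoeba {I : Finset (Fin (n + 1))} (hI : I.Nonempty)
    {θ : Fin (n + 1) → Real.Angle} {v : ℂ}
    (hv : ∀ i ∈ I, 0 < inner ℝ ((θ i).toCircle : ℂ) v) :
    Torus.mk θ ∉ partialCoamoeba I := by
  intro hmem
  set O : Set (Fin (n + 1) → Real.Angle) :=
    {φ | ∀ i ∈ I, 0 < inner ℝ ((φ i).toCircle : ℂ) v} with hO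
  have hOo : IsOpen O := by
    have : O = ⋂ i ∈ I, {φ | 0 < inner ℝ ((φ i).toCircle : ℂ) v} := by
      ext; simp [hO]
    rw [this]
    refine isOpen_biInter_finset fun i _ => isOpen_lt continuous_const ?_
    have : Continuous fun φ : Fin (n + 1) → Real.Angle => ((φ i).toCircle : ℂ) :=
      continuous_subtype_val.comp (continuous_angle_toCircle.comp (continuous_apply i))
    exact this.inner continuous_const
  have himg : IsOpen ((Torus.mk : _ → Torus n) '' O) := QuotientAddGroup.isOpenMap_coe O hOo
  obtain ⟨t, ⟨φ, hφ, rfl⟩, z, hz, hsum, ht⟩ :=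
    mem_closure_iff.1 hmem _ himg ⟨θ, hv, rfl⟩
  obtain ⟨c, hc⟩ := Torus.mk_eq_mk_iff.1 ht.symm
  have key : ∑ i ∈ I, ‖z i‖ • ((φ i).toCircle : ℂ) = 0 := by
    have : ∀ i ∈ I, ‖z i‖ • ((φ i).toCircle : ℂ) = z i * (c.toCircle : ℂ) := by
      intro i _
      have h : (‖z i‖ : ℂ) ≠ 0 := by simpa using hz i
      rw [hc i, Real.Angle.toCircle_add, Circle.coe_mul, toCircle_arg (hz i), Complex.real_smul]
      field_simp
    rw [Finset.sum_congr rfl this, ← Finset.sum_mul, hsum, zero_mul]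
  have hpos : 0 < inner ℝ (∑ i ∈ I, ‖z i‖ • ((φ i).toCircle : ℂ)) v := by
    rw [sum_inner]
    refine Finset.sum_pos (fun i hi => ?_) hI
    rw [real_inner_smul_left]
    exact mul_pos (norm_pos_iff.2 (hz i)) (hφ i hi)
  rw [key, inner_zero_left] at hpos
  exact lt_irrefl _ hpos

theorem mk_mem_partialCoamoeba {I : Finset (Fin (n + 1))} {θ : Fin (n + 1) → Real.Angle}
    (h : ¬ ∃ v : ℂ, ∀ i ∈ I, 0 < inner ℝ ((θ i).toCircle : ℂ) v) :
    Torus.mk θ ∈ partialCoamoeba I := by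
  classical
  obtain ⟨w, ⟨hw0, hw1⟩, hw⟩ := exists_weights_of_forall_not_pos
    (fun i : I => ((θ i).toCircle : ℂ)) (fun ⟨v, hv⟩ => h ⟨v, fun i hi => hv ⟨i, hi⟩⟩)
  obtain ⟨⟨a, ha⟩, hapos⟩ : ∃ a : I, 0 < w a := by
    by_contra hcon
    push Not at hcon
    have := Finset.sum_nonpos (s := Finset.univ) fun i _ => hcon i
    rw [hw1] at this
    linarith
  -- The value off `I` is immaterial as long as it is nonnegative.
  set W : Fin (n + 1) → ℝ := fun i => if hi : i ∈ I then w ⟨i, hi⟩ else 1 with hW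
  have hW0 : ∀ i, 0 ≤ W i := fun i => by
    by_cases hi : i ∈ I <;> simp [hW, hi, hw0]
  have hWa : 0 < W a := by simpa [hW, ha] using hapos
  have hWsum : ∑ i ∈ I, W i • ((θ i).toCircle : ℂ) = 0 := by
    rw [← hw, ← Finset.sum_coe_sort I]
    refine Finset.sum_congr rfl fun i _ => ?_
    simp [hW]
  set S : ℂ := ∑ i ∈ I.erase a, ((θ i).toCircle : ℂ) with hS
  -- Adding `ε` makes every weight positive; the `a`-term absorbs the error, and its argument still
  -- tends to `θ a` because `W a > 0`.
  set z : ℝ → Fin (n + 1) → ℂ := fun ε i =>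
    if i = a then W a • ((θ a).toCircle : ℂ) - ε • S else (W i + ε) • ((θ i).toCircle : ℂ) with hz
  have hza : Tendsto (fun ε : ℝ => W a • ((θ a).toCircle : ℂ) - ε • S) (𝓝[>] 0)
      (𝓝 (W a • ((θ a).toCircle : ℂ))) := by
    have : Continuous fun ε : ℝ => W a • ((θ a).toCircle : ℂ) - ε • S := by fun_prop
    have := this.tendsto 0
    simp only [zero_smul, sub_zero] at this
    exact this.mono_left nhdsWithin_le_nhds
  have hne : W a • ((θ a).toCircle : ℂ) ≠ 0 := smul_ne_zero hWa.ne' (Circle.coe_ne_zero _)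
  have harg : ∀ (r : ℝ) (i), 0 < r →
      (Complex.arg (r • ((θ i).toCircle : ℂ)) : Real.Angle) = θ i := fun r i hr => by
    rw [Complex.real_smul, Complex.arg_real_mul _ hr, Real.Angle.arg_toCircle]
  have hlim : Tendsto (fun ε => Torus.mk fun i => (Complex.arg (z ε i) : Real.Angle)) (𝓝[>] 0)
      (𝓝 (Torus.mk θ)) := by
    refine ((QuotientAddGroup.continuous_mk (N := (Pi.constAddMonoidHom (Fin (n + 1))
      Real.Angle).range)).tendsto θ).comp (tendsto_pi_nhds.2 fun i => ?_)
    by_cases hi : i = a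
    · subst hi
      have := (Complex.continuousAt_arg_coe_angle hne).tendsto.comp hza
      simp only [Function.comp_def, harg _ _ hWa] at this
      simpa only [hz, if_true] using this
    · refine tendsto_const_nhds.congr' ?_
      filter_upwards [self_mem_nhdsWithin] with ε hε
      simp only [hz, if_neg hi]
      exact (harg _ _ (add_pos_of_nonneg_of_pos (hW0 i) hε)).symm
  refine mem_closure_of_tendsto hlim ?_
  filter_upwards [self_mem_nhdsWithin, hza.eventually_ne hne] with ε hε hε'
  refine ⟨z ε, fun i => ?_, ?_, rfl⟩
  · by_cases hi : i = a
    · simpa only [hz, if_pos hi] using hε'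
    · simp only [hz, if_neg hi]
      exact smul_ne_zero (add_pos_of_nonneg_of_pos (hW0 i) hε).ne' (Circle.coe_ne_zero _)
  · rw [← Finset.add_sum_erase I _ ha]
    have : ∀ i ∈ I.erase a, z ε i = W i • ((θ i).toCircle : ℂ) + ε • ((θ i).toCircle : ℂ) := by
      intro i hi
      simp only [hz, if_neg (Finset.ne_of_mem_erase hi), add_smul]
    rw [Finset.sum_congr rfl this, Finset.sum_add_distrib, ← Finset.smul_sum, ← hS]
    rw [← Finset.add_sum_erase I _ ha] at hWsum
    simp only [hz, if_true]
    linear_combination hWsum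

/-- The points of the torus over `x` outside the phase tropical pair-of-pants are those whose
coordinates at the maxima of `x` lie in an open half-circle. -/
theorem notMem_pairOfPants_iff {x : Fin (n + 1) → ℝ} (hx : x ∈ stdSimplex ℝ (Fin (n + 1)))
    (θ : Fin (n + 1) → Real.Angle) :
    (x, Torus.mk θ) ∉ pairOfPants n ↔
      ∃ v : ℂ, ∀ i, (∀ k, x k ≤ x i) → 0 < inner ℝ ((θ i).toCircle : ℂ) v := by
  classical
  constructor
  · contrapose!
    intro h
    set M : Finset (Fin (n + 1)) := Finset.univ.filter fun i => ∀ k, x k ≤ x i with hM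
    have hmem : ∀ i, i ∈ M ↔ ∀ k, x k ≤ x i := fun i => by simp [hM]
    have hnot : ¬ ∃ v : ℂ, ∀ i ∈ M, 0 < inner ℝ ((θ i).toCircle : ℂ) v := by
      rintro ⟨v, hv⟩
      obtain ⟨i, hi, hle⟩ := h v
      exact absurd (hv i ((hmem i).2 hi)) (not_lt.2 hle)
    refine ⟨M, Finset.univ, Finset.subset_univ _, ?_, ⟨hx, ?_, ?_, by simp⟩,
      mk_mem_partialCoamoeba hnot⟩
    · by_contra hlt
      have hle : M.card ≤ 1 := by omega
      obtain ⟨a, _, ha⟩ := Finset.exists_max_image Finset.univ x Finset.univ_nonempty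
      have haM : a ∈ M := (hmem a).2 fun k => ha k (Finset.mem_univ k)
      -- A single maximum is visible from its own direction, so at least two maxima are present.
      refine hnot ⟨((θ a).toCircle : ℂ), fun i hi => ?_⟩
      rw [Finset.card_le_one.1 hle i hi a haM, real_inner_self_eq_norm_sq, Circle.norm_coe]
      norm_num
    · exact fun i hi j hj => le_antisymm ((hmem j).1 hj i) ((hmem i).1 hi j)
    · exact fun i hi k _ => (hmem i).1 hi k
  · rintro ⟨v, hv⟩ ⟨I, J, -, hI, ⟨-, heq, hle, -⟩, ht⟩
    refine mk_notMem_partialCoamoeba (Finset.card_pos.1 (by omega)) (fun i hi => hv i ?_) ht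
    intro k
    by_cases hk : k ∈ I
    · exact (heq k hk i hi).le
    · exact hle i hi k hk

end PhaseTropical

/-! ### Maps to the circle. -/

noncomputable section

namespace PhaseTropical

section Circle

variable {X : Type*} [TopologicalSpace X]

theorem exists_continuousMap_circle_of_ne_zero (f : C(X, ℂ)) (hf : ∀ x, f x ≠ 0) :
    ∃ g : C(X, Circle), ∀ x, (g x : ℂ) = ‖f x‖⁻¹ • f x := by
  refine ⟨⟨fun x => ⟨‖f x‖⁻¹ • f x, mem_sphere_zero_iff_norm.2 ?_⟩, ?_⟩, fun x => rfl⟩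
  · rw [norm_smul, norm_inv, norm_norm, inv_mul_cancel₀ (norm_ne_zero_iff.2 (hf x))]
  · refine Continuous.subtype_mk ?_ _
    exact (f.continuous.norm.inv₀ fun x => norm_ne_zero_iff.2 (hf x)).smul f.continuous

theorem homotopic_of_segment_ne_zero (f g : C(X, Circle))
    (h : ∀ x, ∀ t ∈ Set.Icc (0 : ℝ) 1, (1 - t) • (f x : ℂ) + t • (g x : ℂ) ≠ 0) :
    f.Homotopic g := by
  obtain ⟨H, hH⟩ := exists_continuousMap_circle_of_ne_zero
    (X := unitInterval × X)
    ⟨fun p => (1 - (p.1 : ℝ)) • (f p.2 : ℂ) + (p.1 : ℝ) • (g p.2 : ℂ), by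
      have h1 : Continuous fun p : unitInterval × X => (f p.2 : ℂ) :=
        continuous_subtype_val.comp (f.continuous.comp continuous_snd)
      have h2 : Continuous fun p : unitInterval × X => (g p.2 : ℂ) :=
        continuous_subtype_val.comp (g.continuous.comp continuous_snd)
      fun_prop⟩ fun p => h p.2 p.1 p.1.2
  refine ⟨⟨H, fun x => Circle.ext ?_, fun x => Circle.ext ?_⟩⟩
  · simpa [Circle.norm_coe] using hH (0, x)
  · simpa [Circle.norm_coe] using hH (1, x)

theorem inner_circleExp (q : ℝ) (v : ℂ) :
    inner ℝ (Circle.exp q : ℂ) v = Real.cos q * v.re + Real.sin q * v.im := by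
  rw [Complex.inner, Circle.coe_exp, ← Complex.exp_conj]
  simp [Complex.exp_re, Complex.exp_im]
  ring

/-- A continuous choice of an angle, equal to the argument on the left half of the circle. -/
def leftAngle (u : Circle) : ℝ := Real.pi - Real.arcsin (u : ℂ).im

theorem continuous_leftAngle : Continuous leftAngle :=
  continuous_const.sub (Real.continuous_arcsin.comp
    (Complex.continuous_im.comp continuous_subtype_val))

theorem leftAngle_mem (u : Circle) :
    leftAngle u ∈ Set.Icc (Real.pi / 2) (3 * Real.pi / 2) := by
  have h1 := Real.arcsin_le_pi_div_two (u : ℂ).im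
  have h2 := Real.neg_pi_div_two_le_arcsin (u : ℂ).im
  constructor <;> unfold leftAngle <;> linarith

theorem leftAngle_mem_Icc (u : Circle) : leftAngle u ∈ Set.Icc 0 (2 * Real.pi) := by
  have := Real.pi_pos
  constructor <;> linarith [(leftAngle_mem u).1, (leftAngle_mem u).2]

theorem inner_circleExp_of_re_nonpos {u : Circle} (hu : (u : ℂ).re ≤ 0) (q : ℝ) :
    inner ℝ (Circle.exp q : ℂ) (u : ℂ) = Real.cos (q - leftAngle u) := by
  have hn : (u : ℂ).re ^ 2 + (u : ℂ).im ^ 2 = 1 := by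
    have := Circle.normSq_coe u
    rw [Complex.normSq_apply] at this
    linarith
  have him : |(u : ℂ).im| ≤ 1 := by rw [← sq_le_one_iff_abs_le_one]; nlinarith
  have hc : Real.cos (leftAngle u) = (u : ℂ).re := by
    rw [leftAngle, Real.cos_pi_sub, Real.cos_arcsin,
      show 1 - (u : ℂ).im ^ 2 = (-(u : ℂ).re) ^ 2 by linarith, Real.sqrt_sq (by linarith), neg_neg]
  have hs : Real.sin (leftAngle u) = (u : ℂ).im := by
    rw [leftAngle, Real.sin_pi_sub, Real.sin_arcsin (abs_le.1 him).1 (abs_le.1 him).2]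
  rw [inner_circleExp, Real.cos_sub, hc, hs]

end Circle

/-! ### Marked families and their homotopy equivalence with the circle. -/

/-- A convex family of configurations of points on the line `[0, 2π]`, some of which are fixed at
the origin, that can be contracted by moving all the other points to any prescribed place. -/
structure MarkedFamily (ι E : Type*) [NormedAddCommGroup E] [NormedSpace ℝ E] where
  /-- the relevant points -/
  face : Finset ι
  /-- the parameters of the family -/
  params : Set E
  convex_params : Convex ℝ params
  /-- the positions of the points -/
  pos : ι → E →L[ℝ] ℝ
  pos_mem : ∀ α ∈ params, ∀ i ∈ face, pos i α ∈ Set.Icc 0 (2 * Real.pi)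
  /-- the configuration with all the moving points at a given place -/
  center : ℝ → E
  continuous_center : Continuous center
  center_mem : ∀ c ∈ Set.Icc 0 (2 * Real.pi), center c ∈ params
  pos_center : ∀ c, ∀ i ∈ face, pos i (center c) = c ∨ ∀ α ∈ params, pos i α = 0
  exists_fixed : ∃ i ∈ face, ∀ α ∈ params, pos i α = 0
  exists_moving : ∃ i ∈ face, ∀ c, pos i (center c) = c

namespace MarkedFamily

variable {ι E : Type*} [Fintype ι] [NormedAddCommGroup E] [NormedSpace ℝ E]
  (F : MarkedFamily ι E)

/-- The points on the unit circle. -/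
def point (i : ι) (α : E) : ℂ := Circle.exp (F.pos i α)

omit [Fintype ι] in
theorem continuous_point (i : ι) : Continuous (F.point i) :=
  continuous_subtype_val.comp (Circle.exp.continuous.comp (F.pos i).continuous)

/-- The points at which `x` is maximal lie in the open half-plane in direction `v`. -/
def Sees (x : ι → ℝ) (α : E) (v : ℂ) : Prop :=
  ∀ i, (∀ k, x k ≤ x i) → 0 < inner ℝ (F.point i α) v

/-- The face of the simplex spanned by the relevant points. -/
def simplex : Set (ι → ℝ) := {x | x ∈ stdSimplex ℝ ι ∧ ∀ j, j ∉ F.face → x j = 0}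

/-- The pairs `(x, α)` for which the points where `x` is maximal lie in an open half-circle. -/
def space : Set ((ι → ℝ) × E) :=
  {p | p.1 ∈ F.simplex ∧ p.2 ∈ F.params ∧ ∃ v, F.Sees p.1 p.2 v}

theorem convex_simplex : Convex ℝ F.simplex := by
  intro x hx y hy a b ha hb hab
  refine ⟨convex_stdSimplex ℝ ι hx.1 hy.1 ha hb hab, fun j hj => ?_⟩
  simp [hx.2 j hj, hy.2 j hj]

variable {F}

theorem exists_max {x : ι → ℝ} (hx : x ∈ F.simplex) :
    ∃ i ∈ F.face, 0 < x i ∧ ∀ k, x k ≤ x i := by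
  obtain ⟨⟨h0, h1⟩, hJ⟩ := hx
  have hne : (Finset.univ : Finset ι).Nonempty := by
    by_contra hcon
    rw [Finset.not_nonempty_iff_eq_empty] at hcon
    simp [hcon] at h1
  obtain ⟨a, -, ha⟩ := Finset.exists_max_image Finset.univ x hne
  have hpos : 0 < x a := by
    by_contra hcon
    have := Finset.sum_nonpos (s := Finset.univ) (f := x)
      fun i hi => (ha i hi).trans (not_lt.1 hcon)
    linarith
  refine ⟨a, ?_, hpos, fun k => ha k (Finset.mem_univ k)⟩
  by_contra hcon
  exact hpos.ne' (hJ a hcon)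

variable (F) in
open Classical in
/-- Unnormalized weights concentrated on the points in the open half-plane in direction `v`. -/
def weight (α : E) (v : ℂ) (i : ι) : ℝ :=
  if i ∈ F.face then max 0 (inner ℝ (F.point i α) v) else 0

variable (F) in
/-- The sum of the weights. -/
def total (α : E) (v : ℂ) : ℝ := ∑ i, F.weight α v i

variable (F) in
/-- The point of the simplex given by the normalized weights. -/
def bary (α : E) (v : ℂ) (i : ι) : ℝ := F.weight α v i / F.total α v

omit [Fintype ι] in
theorem weight_nonneg (α : E) (v : ℂ) (i : ι) : 0 ≤ F.weight α v i := by
  unfold weight; split_ifs <;> simp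

omit [Fintype ι] in
theorem weight_pos_iff {α : E} {v : ℂ} {i : ι} :
    0 < F.weight α v i ↔ i ∈ F.face ∧ 0 < inner ℝ (F.point i α) v := by
  unfold weight; split_ifs with h <;> simp [h]

theorem total_pos_iff {α : E} {v : ℂ} :
    0 < F.total α v ↔ ∃ i ∈ F.face, 0 < inner ℝ (F.point i α) v := by
  rw [total, Finset.sum_pos_iff_of_nonneg fun i _ => weight_nonneg α v i]
  simp [weight_pos_iff]

theorem total_pos_of_sees {x : ι → ℝ} {α : E} {v : ℂ} (hx : x ∈ F.simplex)
    (h : F.Sees x α v) : 0 < F.total α v := by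
  obtain ⟨i, hi, -, hmax⟩ := exists_max hx
  exact total_pos_iff.2 ⟨i, hi, h i hmax⟩

theorem bary_nonneg (α : E) (v : ℂ) (i : ι) : 0 ≤ F.bary α v i :=
  div_nonneg (weight_nonneg α v i) (Finset.sum_nonneg fun j _ => weight_nonneg α v j)

theorem bary_mem {α : E} {v : ℂ} (h : 0 < F.total α v) : F.bary α v ∈ F.simplex := by
  refine ⟨⟨bary_nonneg α v, ?_⟩, fun j hj => ?_⟩
  · simp only [bary, ← Finset.sum_div]
    exact div_self h.ne'
  · simp [bary, weight, hj]

theorem inner_pos_of_bary_pos {α : E} {v : ℂ} {i : ι} (h : 0 < F.bary α v i) :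
    0 < inner ℝ (F.point i α) v := by
  have hw : 0 < F.weight α v i := (weight_nonneg α v i).lt_of_ne fun h0 => by
    simp [bary, ← h0] at h
  exact (weight_pos_iff.1 hw).2

theorem sees_bary {α : E} {v : ℂ} (h : 0 < F.total α v) : F.Sees (F.bary α v) α v := by
  intro i hi
  obtain ⟨m, -, hm, -⟩ := exists_max (bary_mem h)
  exact inner_pos_of_bary_pos (hm.trans_le (hi m))

/-- An index invisible from `v` has zero barycentric weight, while a maximum of `x` has positive
weight. For `t > 0` the latter therefore strictly beats the former. -/
theorem sees_segment {x : ι → ℝ} {α : E} {v : ℂ} (hx : x ∈ F.simplex) (h : F.Sees x α v)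
    {t : ℝ} (ht : t ∈ Set.Icc (0 : ℝ) 1) : F.Sees ((1 - t) • x + t • F.bary α v) α v := by
  intro i hi
  by_contra hcon
  have hbi : F.bary α v i = 0 :=
    le_antisymm (not_lt.1 fun hb => hcon (inner_pos_of_bary_pos hb)) (bary_nonneg α v i)
  obtain ⟨m, hmJ, -, hm⟩ := exists_max hx
  have hbm : 0 < F.bary α v m :=
    div_pos (weight_pos_iff.2 ⟨hmJ, h m hm⟩) (total_pos_of_sees hx h)
  have h1 := hi m
  simp only [Pi.add_apply, Pi.smul_apply, smul_eq_mul, hbi, mul_zero, add_zero] at h1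
  have h2 := mul_le_mul_of_nonneg_left (hm i) (sub_nonneg.2 ht.2)
  have h3 : t = 0 := by
    by_contra hne
    have := mul_pos (ht.1.lt_of_ne' hne) hbm
    linarith
  subst h3
  exact hcon (h i fun k => by simpa using hi k)

theorem continuous_bary {X : Type*} [TopologicalSpace X] {a : X → E} {v : X → ℂ}
    (ha : Continuous a) (hv : Continuous v) (hpos : ∀ x, 0 < F.total (a x) (v x)) :
    Continuous fun x => F.bary (a x) (v x) := by
  have hw : ∀ i, Continuous fun x => F.weight (a x) (v x) i := fun i => by
    unfold weight
    split_ifs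
    · exact continuous_const.max (((F.continuous_point i).comp ha).inner hv)
    · exact continuous_const
  refine continuous_pi fun i => (hw i).div ?_ fun x => (hpos x).ne'
  exact continuous_finsetSum _ fun i _ => hw i

theorem total_center_pos (u : Circle) : 0 < F.total (F.center (leftAngle u)) u := by
  rw [total_pos_iff]
  by_cases hu : (u : ℂ).re ≤ 0
  · obtain ⟨j, hj, hjc⟩ := F.exists_moving
    refine ⟨j, hj, ?_⟩
    rw [point, inner_circleExp_of_re_nonpos hu, hjc, sub_self, Real.cos_zero]
    exact one_pos
  · obtain ⟨i, hi, hi0⟩ := F.exists_fixed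
    refine ⟨i, hi, ?_⟩
    rw [point, inner_circleExp, hi0 _ (F.center_mem _ (leftAngle_mem_Icc u))]
    simpa using hu

omit [Fintype ι] in
theorem segment_center_mem (u : Circle) {α : E} (hα : α ∈ F.params) {t : ℝ}
    (ht : t ∈ Set.Icc (0 : ℝ) 1) : (1 - t) • α + t • F.center (leftAngle u) ∈ F.params :=
  F.convex_params hα (F.center_mem _ (leftAngle_mem_Icc u)) (sub_nonneg.2 ht.2) ht.1 (by ring)

/-- If `u` points right, the fixed point stays visible. Otherwise a visible moving point only gets
closer to the angle of `u`. -/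
theorem total_segment_pos {u : Circle} {α : E} (hα : α ∈ F.params) (h : 0 < F.total α u) {t : ℝ}
    (ht : t ∈ Set.Icc (0 : ℝ) 1) :
    0 < F.total ((1 - t) • α + t • F.center (leftAngle u)) u := by
  rw [total_pos_iff] at h ⊢
  by_cases hu : (u : ℂ).re ≤ 0
  · obtain ⟨i, hi, hpos⟩ := h
    refine ⟨i, hi, ?_⟩
    have hc := leftAngle_mem u
    rw [point, inner_circleExp_of_re_nonpos hu] at hpos ⊢
    rcases F.pos_center (leftAngle u) i hi with hcen | h0
    · rw [map_add, map_smul, map_smul, hcen, smul_eq_mul, smul_eq_mul]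
      obtain ⟨hq0, hq1⟩ := F.pos_mem α hα i hi
      -- Positions in `[0, 2π]` and `leftAngle u` in `[π/2, 3π/2]` differ by at most `3π/2`, so a
      -- positive cosine forces the real distance, not just the distance mod `2π`, below `π/2`.
      have habs : |F.pos i α - leftAngle u| < Real.pi / 2 := by
        by_contra hcon
        rw [← Real.cos_abs] at hpos
        refine absurd hpos (not_lt.2 (Real.cos_nonpos_of_pi_div_two_le_of_le (not_lt.1 hcon) ?_))
        rw [abs_le]
        constructor <;> linarith [hc.1, hc.2]
      rw [show (1 - t) * F.pos i α + t * leftAngle u - leftAngle u =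
        (1 - t) * (F.pos i α - leftAngle u) by ring]
      apply Real.cos_pos_of_mem_Ioo
      rw [Set.mem_Ioo, ← abs_lt, abs_mul, abs_of_nonneg (sub_nonneg.2 ht.2)]
      nlinarith [abs_nonneg (F.pos i α - leftAngle u), ht.1]
    · rw [h0 _ hα] at hpos
      rwa [h0 _ (segment_center_mem u hα ht)]
  · obtain ⟨i, hi, hi0⟩ := F.exists_fixed
    refine ⟨i, hi, ?_⟩
    rw [point, inner_circleExp, hi0 _ (segment_center_mem u hα ht)]
    simpa using hu

omit [Fintype ι] in
theorem convex_setOf_sees (x : ι → ℝ) (α : E) : Convex ℝ {v | F.Sees x α v} := by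
  intro v hv w hw a b ha hb hab i hi
  rw [inner_add_right, inner_smul_right, inner_smul_right]
  rcases ha.eq_or_lt with rfl | ha
  · simpa [show b = 1 by linarith] using hw i hi
  · exact add_pos_of_pos_of_nonneg (mul_pos ha (hv i hi)) (mul_nonneg hb (hw i hi).le)

/-- Indices that are not maximal at `x` remain so nearby, and visibility of the others is an open
condition. -/
theorem eventually_sees {x : ι → ℝ} {α : E} {v : ℂ} (h : F.Sees x α v) :
    ∀ᶠ p : (ι → ℝ) × E in 𝓝 (x, α), F.Sees p.1 p.2 v := by
  refine Filter.eventually_all.2 fun i => ?_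
  by_cases hi : ∀ k, x k ≤ x i
  · have hc : Continuous fun p : (ι → ℝ) × E => (inner ℝ (F.point i p.2) v : ℝ) :=
      ((F.continuous_point i).comp continuous_snd).inner continuous_const
    filter_upwards [hc.continuousAt.eventually_const_lt (h i hi)] with p hp _ using hp
  · push Not at hi
    obtain ⟨k, hk⟩ := hi
    have h1 : Continuous fun p : (ι → ℝ) × E => p.1 i := by fun_prop
    have h2 : Continuous fun p : (ι → ℝ) × E => p.1 k := by fun_prop
    filter_upwards [h1.continuousAt.eventually_lt h2.continuousAt hk] with p hp hmax
    exact absurd (hmax k) (not_le.2 hp)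

variable (F) in
theorem exists_direction : ∃ f : C(F.space, Circle), ∀ p, F.Sees p.1.1 p.1.2 (f p) := by
  obtain ⟨f, hf⟩ := exists_continuous_forall_mem_convex_of_local_const
    (X := F.space) (E := ℂ) (t := fun p => {v | F.Sees p.1.1 p.1.2 v})
    (fun p => convex_setOf_sees _ _) fun p => by
      obtain ⟨v, hv⟩ := p.2.2.2
      exact ⟨v, continuous_subtype_val.continuousAt.eventually (eventually_sees hv)⟩
  have hne : ∀ p, f p ≠ 0 := fun p h0 => by
    obtain ⟨i, -, -, hi⟩ := exists_max p.2.1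
    have := hf p i hi
    rw [h0, inner_zero_right] at this
    exact lt_irrefl _ this
  obtain ⟨g, hg⟩ := exists_continuousMap_circle_of_ne_zero f hne
  refine ⟨g, fun p i hi => ?_⟩
  rw [hg, inner_smul_right]
  exact mul_pos (inv_pos.2 (norm_pos_iff.2 (hne p))) (hf p i hi)

variable (F) in
/-- The loop in the space that runs once around the circle of directions. -/
def loop : C(Circle, F.space) where
  toFun u := ⟨(F.bary (F.center (leftAngle u)) u, F.center (leftAngle u)),
    bary_mem (total_center_pos u), F.center_mem _ (leftAngle_mem_Icc u), u,
    sees_bary (total_center_pos u)⟩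
  continuous_toFun := by
    have h := F.continuous_center.comp continuous_leftAngle
    exact ((continuous_bary h continuous_subtype_val total_center_pos).prodMk h).subtype_mk _

theorem comp_loop_homotopic_id (f : C(F.space, Circle))
    (hf : ∀ p, F.Sees p.1.1 p.1.2 (f p)) :
    (f.comp F.loop).Homotopic (ContinuousMap.id Circle) := by
  refine homotopic_of_segment_ne_zero _ _ fun u t ht h0 => ?_
  obtain ⟨i, -, -, hi⟩ := exists_max (F.loop u).2.1
  have h1 := hf (F.loop u) i hi
  have h2 : 0 < inner ℝ (F.point i (F.loop u).1.2) (u : ℂ) := sees_bary (total_center_pos u) i hi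
  have := convex_setOf_sees (F.loop u).1.1 (F.loop u).1.2 (hf (F.loop u))
    (sees_bary (total_center_pos u)) (sub_nonneg.2 ht.2) ht.1 (by ring) i hi
  exact this.ne' ((congrArg (inner ℝ _) h0).trans (inner_zero_right _))

theorem loop_comp_homotopic_id (f : C(F.space, Circle))
    (hf : ∀ p, F.Sees p.1.1 p.1.2 (f p)) :
    (F.loop.comp f).Homotopic (ContinuousMap.id F.space) := by
  have hfc : Continuous fun p : F.space => (f p : ℂ) := continuous_subtype_val.comp f.continuous
  have htot : ∀ p, 0 < F.total p.1.2 (f p) := fun p => total_pos_of_sees p.2.1 (hf p)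
  have hα : Continuous fun p : F.space => p.1.2 := continuous_snd.comp continuous_subtype_val
  have hx : Continuous fun p : F.space => p.1.1 := continuous_fst.comp continuous_subtype_val
  have hb := continuous_bary hα hfc htot
  -- The intermediate stage: `x` is already replaced by the visible weights, `α` is unchanged.
  let h : C(F.space, F.space) :=
    ⟨fun p => ⟨(F.bary p.1.2 (f p), p.1.2), bary_mem (htot p), p.2.2.1, f p, sees_bary (htot p)⟩,
      (hb.prodMk hα).subtype_mk _⟩
  have ht : Continuous fun q : unitInterval × F.space => (q.1 : ℝ) :=
    continuous_subtype_val.comp continuous_fst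
  have h1 : (ContinuousMap.id F.space).Homotopic h := by
    refine ⟨⟨⟨fun q => ⟨((1 - (q.1 : ℝ)) • q.2.1.1 + (q.1 : ℝ) • F.bary q.2.1.2 (f q.2), q.2.1.2),
      F.convex_simplex q.2.2.1 (bary_mem (htot q.2)) (sub_nonneg.2 q.1.2.2) q.1.2.1 (by ring),
      q.2.2.2.1, f q.2, sees_segment q.2.2.1 (hf q.2) q.1.2⟩, ?_⟩, fun p => ?_, fun p => ?_⟩⟩
    · refine Continuous.subtype_mk (Continuous.prodMk ?_ (hα.comp continuous_snd)) _
      exact ((continuous_const.sub ht).smul (hx.comp continuous_snd)).add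
        (ht.smul (hb.comp continuous_snd))
    · apply Subtype.ext; simp
    · apply Subtype.ext; simp [h]
  have h2 : h.Homotopic (F.loop.comp f) := by
    have hseg : Continuous fun q : unitInterval × F.space =>
        (1 - (q.1 : ℝ)) • q.2.1.2 + (q.1 : ℝ) • F.center (leftAngle (f q.2)) :=
      ((continuous_const.sub ht).smul (hα.comp continuous_snd)).add
        (ht.smul (F.continuous_center.comp (continuous_leftAngle.comp
          (f.continuous.comp continuous_snd))))
    have hpos : ∀ q : unitInterval × F.space, 0 < F.total
        ((1 - (q.1 : ℝ)) • q.2.1.2 + (q.1 : ℝ) • F.center (leftAngle (f q.2))) (f q.2) :=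
      fun q => total_segment_pos q.2.2.2.1 (htot q.2) q.1.2
    refine ⟨⟨⟨fun q => ⟨(F.bary ((1 - (q.1 : ℝ)) • q.2.1.2 +
        (q.1 : ℝ) • F.center (leftAngle (f q.2))) (f q.2),
        (1 - (q.1 : ℝ)) • q.2.1.2 + (q.1 : ℝ) • F.center (leftAngle (f q.2))),
      bary_mem (hpos q), segment_center_mem _ q.2.2.2.1 q.1.2, f q.2, sees_bary (hpos q)⟩, ?_⟩,
      fun p => ?_, fun p => ?_⟩⟩
    · exact ((continuous_bary hseg (hfc.comp continuous_snd) hpos).prodMk hseg).subtype_mk _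
    · apply Subtype.ext; simp [h]
    · apply Subtype.ext; simp [loop]
  exact (h1.trans h2).symm

variable (F) in
theorem nonempty_homotopyEquiv_circle : Nonempty (F.space ≃ₕ Circle) := by
  obtain ⟨f, hf⟩ := F.exists_direction
  exact ⟨⟨f, F.loop, loop_comp_homotopic_id f hf, comp_loop_homotopic_id f hf⟩⟩

end MarkedFamily

end PhaseTropical

end

/-! ### Cyclic partitions as marked families. -/

noncomputable section

namespace PhaseTropical

namespace CyclicPartition

variable {n : ℕ} (σ : CyclicPartition n)

/-- The position of the part `s`, relative to the first part. -/
def height (s : Fin σ.card) : (Fin σ.card → ℝ) →L[ℝ] ℝ :=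
  ∑ r with r < s, ContinuousLinearMap.proj r

theorem height_apply (s : Fin σ.card) (α : Fin σ.card → ℝ) :
    σ.height s α = ∑ r with r < s, α r := by
  simp [height]

theorem height_sub_mem {α : Fin σ.card → ℝ} (hα : α ∈ σ.simplex) {s t : Fin σ.card}
    (hst : s ≤ t) : σ.height t α - σ.height s α ∈ Set.Icc 0 (2 * Real.pi) := by
  rw [height_apply, height_apply]
  have hsub : (Finset.univ.filter fun r => r < s) ⊆ Finset.univ.filter fun r => r < t := by
    intro r hr
    simp only [Finset.mem_filter, Finset.mem_univ, true_and] at hr ⊢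
    exact hr.trans_le hst
  have h1 := Finset.sum_le_sum_of_subset_of_nonneg hsub fun r _ _ => hα.1 r
  have h2 := Finset.sum_le_sum_of_subset_of_nonneg
    (Finset.filter_subset (fun r => r < t) Finset.univ) fun r _ _ => hα.1 r
  have h3 := Finset.sum_nonneg (s := Finset.univ.filter fun r => r < s) fun r _ => hα.1 r
  rw [hα.2] at h2
  constructor <;> linarith

theorem convex_simplex : Convex ℝ σ.simplex := by
  intro α hα β hβ a b ha hb hab
  refine ⟨fun s => add_nonneg (mul_nonneg ha (hα.1 s)) (mul_nonneg hb (hβ.1 s)), ?_⟩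
  simp only [Pi.add_apply, Pi.smul_apply, smul_eq_mul, Finset.sum_add_distrib, ← Finset.mul_sum,
    hα.2, hβ.2]
  rw [← add_mul, hab, one_mul]

/-- The point of `Δ_σ` on the edge between `s` and `t` with `s`-coordinate `c`. -/
def edgePoint (s t : Fin σ.card) (c : ℝ) : Fin σ.card → ℝ :=
  Pi.single s c + Pi.single t (2 * Real.pi - c)

theorem edgePoint_mem (s t : Fin σ.card) {c : ℝ} (hc : c ∈ Set.Icc 0 (2 * Real.pi)) :
    σ.edgePoint s t c ∈ σ.simplex := by
  have h1 : (0 : Fin σ.card → ℝ) ≤ Pi.single s c := Pi.single_nonneg.2 hc.1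
  have h2 : (0 : Fin σ.card → ℝ) ≤ Pi.single t (2 * Real.pi - c) :=
    Pi.single_nonneg.2 (sub_nonneg.2 hc.2)
  refine ⟨fun r => add_nonneg (h1 r) (h2 r), ?_⟩
  · simp [edgePoint, Finset.sum_add_distrib]

/-- Between `s` and `r` only the coordinate `s` of the edge point contributes, since `t` is not
below `r`. Hence all the moving parts are gathered at `c`. -/
theorem height_edgePoint_sub {s t r : Fin σ.card} (hsr : s < r) (hrt : r ≤ t) (c : ℝ) :
    σ.height r (σ.edgePoint s t c) - σ.height s (σ.edgePoint s t c) = c := by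
  have hst : s < t := hsr.trans_le hrt
  simp [height_apply, edgePoint, Finset.sum_add_distrib, Pi.single_apply, Finset.sum_ite_eq',
    hsr, hrt.not_gt, hst.not_gt]

theorem exists_extremal_parts {J : Finset (Fin (n + 1))} (h : σ.Divides J) :
    ∃ a ∈ J, ∃ b ∈ J, σ.part a < σ.part b ∧
      ∀ i ∈ J, σ.part a ≤ σ.part i ∧ σ.part i ≤ σ.part b := by
  obtain ⟨i, hi, j, hj, hij⟩ := h
  obtain ⟨a, ha, hamin⟩ := Finset.exists_min_image J σ.part ⟨i, hi⟩
  obtain ⟨b, hb, hbmax⟩ := Finset.exists_max_image J σ.part ⟨i, hi⟩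
  refine ⟨a, ha, b, hb, lt_of_not_ge fun hba => hij ?_, fun k hk => ⟨hamin k hk, hbmax k hk⟩⟩
  exact le_antisymm ((hbmax i hi).trans (hba.trans (hamin j hj)))
    ((hbmax j hj).trans (hba.trans (hamin i hi)))

/-- The configurations of the points with indices in `J` given by the points of `Δ_σ`,
relative to the first part that meets `J`. -/
def markedFamily (J : Finset (Fin (n + 1))) {a b : Fin (n + 1)} (ha : a ∈ J) (hb : b ∈ J)
    (hab : σ.part a < σ.part b)
    (hJ : ∀ i ∈ J, σ.part a ≤ σ.part i ∧ σ.part i ≤ σ.part b) :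
    MarkedFamily (Fin (n + 1)) (Fin σ.card → ℝ) where
  face := J
  params := σ.simplex
  convex_params := σ.convex_simplex
  pos i := σ.height (σ.part i) - σ.height (σ.part a)
  pos_mem _ hα i hi := σ.height_sub_mem hα (hJ i hi).1
  center := σ.edgePoint (σ.part a) (σ.part b)
  continuous_center := by
    unfold edgePoint
    refine Continuous.add (continuous_single (A := fun _ => ℝ) (σ.part a)) ?_
    exact (continuous_single (A := fun _ => ℝ) (σ.part b)).comp (continuous_const.sub continuous_id)
  center_mem _ hc := σ.edgePoint_mem _ _ hc
  pos_center c i hi := by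
    rcases (hJ i hi).1.eq_or_lt with h | h
    · exact Or.inr fun α _ => by rw [h, sub_self]; rfl
    · exact Or.inl (σ.height_edgePoint_sub h (hJ i hi).2 c)
  exists_fixed := ⟨a, ha, fun α _ => by rw [sub_self]; rfl⟩
  exists_moving := ⟨b, hb, fun c => σ.height_edgePoint_sub hab le_rfl c⟩

/-- The diagonal rotation is free, so the origin can be put at a part that meets `J`. -/
theorem toTorus_eq (s : Fin σ.card) (α : Fin σ.card → ℝ) :
    σ.toTorus α = Torus.mk fun i =>
      (((σ.height (σ.part i) - σ.height s) α : ℝ) : Real.Angle) := by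
  refine Torus.mk_eq_mk_iff.2 ⟨-(σ.height s α : Real.Angle), fun i => ?_⟩
  rw [sub_apply, Real.Angle.coe_sub, height_apply, sub_eq_add_neg]

theorem sdiff_pantsStratum_eq_space (J : Finset (Fin (n + 1))) {a b : Fin (n + 1)} (ha : a ∈ J)
    (hb : b ∈ J) (hab : σ.part a < σ.part b)
    (hJ : ∀ i ∈ J, σ.part a ≤ σ.part i ∧ σ.part i ≤ σ.part b) :
    (simplexFace J ×ˢ σ.simplex) \ σ.pantsStratum J =
      (σ.markedFamily J ha hb hab hJ).space := by
  ext ⟨x, α⟩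
  have key (hx : x ∈ simplexFace J) : (x, σ.toTorus α) ∉ pairOfPants n ↔
      ∃ v, (σ.markedFamily J ha hb hab hJ).Sees x α v := by
    rw [σ.toTorus_eq (σ.part a), notMem_pairOfPants_iff hx.1]
    rfl
  constructor
  · rintro ⟨⟨hx, hα⟩, hP⟩
    exact ⟨hx, hα, (key hx).1 fun h => hP ⟨hx, hα, h⟩⟩
  · rintro ⟨hx, hα, hv⟩
    exact ⟨⟨hx, hα⟩, fun hP => (key hx).2 hv hP.2.2⟩

end CyclicPartition

end PhaseTropical

end

theorem mainTheorem3 (n : ℕ) (σ : PhaseTropical.CyclicPartition n)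
    (J : Finset (Fin (n + 1))) (hσJ : σ.Divides J) :
    Nonempty
      (((PhaseTropical.simplexFace J ×ˢ σ.simplex) \ σ.pantsStratum J :
          Set ((Fin (n + 1) → ℝ) × (Fin σ.card → ℝ))) ≃ₕ Circle) := by
  obtain ⟨a, ha, b, hb, hab, hJ⟩ := σ.exists_extremal_parts hσJ
  rw [σ.sdiff_pantsStratum_eq_space J ha hb hab hJ]
  exact PhaseTropical.MarkedFamily.nonempty_homotopyEquiv_circle _
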